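/- Let $X$ be a finite set of $n$ clocks and let a valuation be a map $v:X\to\mathbb{R}_{\ge 0}$. Let $\mathcal G$ be a finite set of atomic constraints $x\triangleleft c$, $c\triangleleft x$ (with $c\in\mathbb N$) and $x-y\triangleleft c$ (diagonal constraints, with $c\in\mathbb Z$), where $\triangleleft\in\{<,\le\}$. Let $d$ be the number of diagonal constraints in $\mathcal G$, and let $\mathcal G^-$ be the set of non-diagonal constraints in $\mathcal G$. Write $v\sqsubseteq_{\mathcal G}v'$ if for all $\varphi\in\mathcal G$ and $\delta\ge 0$, $v+\delta\models\varphi$ implies $v'+\delta\models\varphi$. Let $L(x)$ (resp. $U(x)$) be the largest $c$ such that a constraint $c\triangleleft x$ (resp. $x\triangleleft c$) is in $\mathcal G$, and $-\infty$ if there is none. Write $v\preccurlyeq_{LU(\mathcal G)}v'$ if for every clock $x$: $v'(x)<v(x)$ implies $L(x)<v'(x)$, and $v(x)<v'(x)$ implies $U(x)<v(x)$. Write $v\sqsubseteq^{LU}_{\mathcal G}v'$ if $v\preccurlyeq_{LU(\mathcal G)}v'$ and every diagonal constraint of $\mathcal G$ satisfied by $v$ is satisfied by $v'$. A relation $R$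 on valuations is extended to sets by: $Z\,R\,Z'$ iff for every $v\in Z$ there is $v'\in Z'$ with $v\,R\,v'$. A zone is the set of solutions of a finite conjunction of constraints $x\triangleleft c$, $c\triangleleft x$, $x-y\triangleleft c$ with $c\in\mathbb Z$. Zones are represented by a special value for the empty zone, and by difference bound matrices (DBMs) in canonical (shortest-path closed) form for the others. Consider the following mutually recursive procedures. Algorithm 1, check $Z\sqsubseteq_{\mathcal G}Z'$: if $Z=\emptyset$, return true; if $Z'=\emptyset$, return false; if the oracle for $Z\sqsubseteq_{\mathcal G^-}Z'$ answers no, return false; return (check $Z\sqsubseteq^*_{\mathcal G}Z'$). Algorithm 2, check $Z\sqsubseteq^*_{\mathcal G}Z'$: if $\mathcal G$ has no diagonal constraint, return true; otherwise pick any diagonal constraint $\varphi\in\mathcal G$ and let $\mathcal G'=\mathcal G\setminus\{\varphi\}$; if $Z\cap\neg\varphi\neq\emptyset$ and (check $Z\cap\neg\varphi\sqsubseteq^*_{\mathcal G'}Z'$) returns false, return false; return (check $Z\cap\varphi\sqsubseteq_{\mathcal G'}Z'\cap\varphi$). Intersection with a single constraint is computed on canonical DBMs by testing whether the new bound closes a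 negative cycle and otherwise updating each entry once (minimum of the entry and of the path through the new bound). The test $Z\preccurlyeq_{LU(\mathcal G)}Z'$, for non-empty zones given by canonical DBMs with $Z_{xy}$ the bound on $x-y$ and $0$ the reference clock ($L(0)=U(0)=0$), answers no iff some indices $x,y\in X\cup\{0\}$ with $L(y),U(x)\neq-\infty$ satisfy $(\le,-U(x))\le Z_{0x}$, $Z'_{yx}<Z_{yx}$ and $Z'_{yx}+(<,-L(y))<Z_{0x}$; it searches all pairs. Time is the number of elementary steps: reading or writing a DBM entry, adding or comparing two bounds, a Boolean operation, a loop iteration, a call or return, an emptiness test each cost one step; allocating a DBM costs the number of its entries, and removing the $k$-th element of the list of diagonal constraints costs $k$ steps. The functions $L,U$ and the list of the diagonal constraints of the fixed set $\mathcal G$ are given. Then: 1. Every zone has a representation of the above form. 2. With an oracle that decides $Z\sqsubseteq_{\mathcal G^-}Z'$ exactly for non-empty zones, every execution of Algorithm 1 on representations of zones $Z,Z'$ terminates, for all choices of the picked constraints, and it returns true iff $Z\sqsubseteq_{\mathcal G}Z'$. 3. When the test $Z\preccurlyeq_{LU(\mathcal G)}Z'$ is used in place of $Z\sqsubseteq_{\mathcal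 G^-}Z'$, every execution terminates, for all choices of the picked constraints; it returns true iff $Z\sqsubseteq^{LU}_{\mathcal G}Z'$; and, if $X\neq\emptyset$, it takes time $O(2^d\cdot|X|^2)$: there is an absolute constant $C$, independent of $X$, $\mathcal G$, $Z$, $Z'$, such that it takes at most $C\cdot 2^d\cdot|X|^2$ elementary steps. -/

import Mathlib

open scoped NNReal

namespace TimedZone

/-! ### Constraints, valuations and simulations -/

/-- A strict or non-strict comparison. -/
inductive Cmp
  | lt
  | le

namespace Cmp

def Holds : Cmp → ℝ → ℝ → Prop
  | lt, a, b => a < b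
  | le, a, b => a ≤ b

/-- `¬ (a < b)` is `b ≤ a`, and `¬ (a ≤ b)` is `b < a`. -/
def dual : Cmp → Cmp
  | lt => le
  | le => lt

/-- The comparison obtained by adding two inequalities. -/
def comb : Cmp → Cmp → Cmp
  | le, le => le
  | _, _ => lt

/-- At equal constants, `<` is the strictly tighter comparison. -/
def tighter : Cmp → Cmp → Bool
  | lt, le => true
  | _, _ => false

end Cmp

/-- Clock valuations over `n` clocks. -/
abbrev Valuation (n : ℕ) := Fin n → ℝ≥0

/-- The valuation `v + δ`. -/
def Valuation.delay {n : ℕ} (v : Valuation n) (δ : ℝ≥0) : Valuation n := fun x => v x + δ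

/-- A diagonal constraint `x - y ◁ c`, with `c` an integer. -/
structure Diag (n : ℕ) where
  x : Fin n
  y : Fin n
  cmp : Cmp
  c : ℤ

/-- Atomic constraints: `x ◁ c` and `c ◁ x` with `c` natural, and diagonal constraints. -/
inductive Atom (n : ℕ)
  | upper (x : Fin n) (s : Cmp) (c : ℕ)
  | lower (c : ℕ) (s : Cmp) (x : Fin n)
  | diag (φ : Diag n)

def Diag.Sat {n : ℕ} (v : Valuation n) (φ : Diag n) : Prop :=
  φ.cmp.Holds ((v φ.x : ℝ) - (v φ.y : ℝ)) (φ.c : ℝ)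

def Atom.Sat {n : ℕ} (v : Valuation n) : Atom n → Prop
  | .upper x s c => s.Holds (v x : ℝ) (c : ℝ)
  | .lower c s x => s.Holds (c : ℝ) (v x : ℝ)
  | .diag φ => φ.Sat v

def Atom.IsDiag {n : ℕ} : Atom n → Prop
  | .diag _ => True
  | _ => False

/-- `v ⊑_G v'`: along every common delay, `v'` satisfies all the constraints of `G` that
`v` satisfies. -/
def GuardSim {n : ℕ} (G : Set (Atom n)) (v v' : Valuation n) : Prop :=
  ∀ φ ∈ G, ∀ δ : ℝ≥0, φ.Sat (v.delay δ) → φ.Sat (v'.delay δ)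

/-- `G⁻`, the non-diagonal constraints of `G`. -/
def nonDiag {n : ℕ} (G : Set (Atom n)) : Set (Atom n) := {φ | φ ∈ G ∧ ¬ φ.IsDiag}

/-- The number of diagonal constraints in `G`. -/
noncomputable def numDiag {n : ℕ} (G : Finset (Atom n)) : ℕ :=
  {φ : Atom n | φ ∈ G ∧ φ.IsDiag}.ncard

/-- `L_G (x) = max {c | c ◁ x ∈ G}`, and `-∞` if there is no such constraint. -/
def lowerBounds {n : ℕ} (G : Finset (Atom n)) (x : Fin n) : WithBot ℕ :=
  G.sup fun φ => match φ with
    | .lower c _ y => if y = x then (c : WithBot ℕ) else ⊥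
    | _ => ⊥

/-- `U_G (x) = max {c | x ◁ c ∈ G}`, and `-∞` if there is no such constraint. -/
def upperBounds {n : ℕ} (G : Finset (Atom n)) (x : Fin n) : WithBot ℕ :=
  G.sup fun φ => match φ with
    | .upper y _ c => if y = x then (c : WithBot ℕ) else ⊥
    | _ => ⊥

/-- `b < r`, for `b` a natural number or `-∞` and `r` a non-negative real. -/
def BelowReal (b : WithBot ℕ) (r : ℝ≥0) : Prop :=
  b.map (fun c : ℕ => (c : ℝ≥0)) < (r : WithBot ℝ≥0)

/-- The relation `v ≼_{LU} v'`. -/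
def LUSim {n : ℕ} (L U : Fin n → WithBot ℕ) (v v' : Valuation n) : Prop :=
  ∀ x, (v' x < v x → BelowReal (L x) (v' x)) ∧ (v x < v' x → BelowReal (U x) (v x))

/-- `v ≼_{LU(G)} v'`, and `v'` satisfies every diagonal constraint of `G` that `v` satisfies. -/
def LUGuardSim {n : ℕ} (G : Finset (Atom n)) (v v' : Valuation n) : Prop :=
  LUSim (lowerBounds G) (upperBounds G) v v' ∧
    ∀ φ : Diag n, Atom.diag φ ∈ G → φ.Sat v → φ.Sat v'

/-- The extension of a relation between valuations to sets of valuations. -/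
def SetSim {n : ℕ} (R : Valuation n → Valuation n → Prop) (Z Z' : Set (Valuation n)) : Prop :=
  ∀ v ∈ Z, ∃ v' ∈ Z', R v v'

/-! ### Zones and difference bound matrices -/

/-- The constraints `x ◁ c`, `c ◁ x` and `x - y ◁ c`, with `c` an integer. -/
inductive ZoneAtom (n : ℕ)
  | upper (x : Fin n) (s : Cmp) (c : ℤ)
  | lower (c : ℤ) (s : Cmp) (x : Fin n)
  | diag (x y : Fin n) (s : Cmp) (c : ℤ)

def ZoneAtom.Sat {n : ℕ} (v : Valuation n) : ZoneAtom n → Prop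
  | .upper x s c => s.Holds (v x : ℝ) (c : ℝ)
  | .lower c s x => s.Holds (c : ℝ) (v x : ℝ)
  | .diag x y s c => s.Holds ((v x : ℝ) - (v y : ℝ)) (c : ℝ)

/-- A zone is the set of solutions of a finite conjunction of constraints. -/
def IsZone {n : ℕ} (Z : Set (Valuation n)) : Prop :=
  ∃ S : Finset (ZoneAtom n), Z = {v | ∀ φ ∈ S, φ.Sat v}

/-- Upper bounds on differences of clocks: no bound, or `◁ c`. -/
inductive Bnd
  | inf
  | fin (s : Cmp) (c : ℤ)

namespace Bnd

def Sat (r : ℝ) : Bnd → Prop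
  | inf => True
  | fin s c => s.Holds r (c : ℝ)

def add : Bnd → Bnd → Bnd
  | fin s c, fin s' c' => fin (s.comb s') (c + c')
  | _, _ => inf

/-- `b.less b'` decides whether `b` is a strictly tighter bound than `b'`. -/
def less : Bnd → Bnd → Bool
  | fin s c, fin s' c' => decide (c < c') || (decide (c = c') && s.tighter s')
  | fin _ _, inf => true
  | inf, _ => false

/-- The bound `≤ 0`. -/
def zero : Bnd := fin .le 0

end Bnd

/-- A difference bound matrix. Index `0` is the reference clock, of constant value `0`, and
index `i + 1` is the clock `i`; the entry `(i, j)` bounds the difference of `i` and `j`. -/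
abbrev DBM (n : ℕ) := Fin (n + 1) → Fin (n + 1) → Bnd

/-- The value of a clock or of the reference clock. -/
def Valuation.ext {n : ℕ} (v : Valuation n) : Fin (n + 1) → ℝ :=
  Fin.cons 0 fun x => (v x : ℝ)

/-- The set of solutions of a difference bound matrix. -/
def DBM.sols {n : ℕ} (M : DBM n) : Set (Valuation n) :=
  {v | ∀ i j, (M i j).Sat (v.ext i - v.ext j)}

/-- Canonical matrices: closed under shortest paths, without negative cycles, and containing
the constraints `0 ≤ x`. Their sets of solutions are exactly the non-empty zones. -/
structure DBM.Canonical {n : ℕ} (M : DBM n) : Prop where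
  diag : ∀ i, M i i = Bnd.zero
  triangle : ∀ i j k, ((M i k).add (M k j)).less (M i j) = false
  nonneg : ∀ j, Bnd.zero.less (M 0 j) = false

/-- The data structure for zones: `none` for the empty zone, or else a matrix. -/
abbrev ZoneRep (n : ℕ) := Option (DBM n)

/-- `M` is the (canonical) representation of the set `Z`. -/
def ZoneRep.Represents {n : ℕ} (M : ZoneRep n) (Z : Set (Valuation n)) : Prop :=
  match M with
  | none => Z = ∅
  | some M => M.Canonical ∧ M.sols = Z

/-! ### Zone operations with a count of elementary steps -/

/-- A result together with the number of elementary steps taken to compute it. -/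
structure Timed (α : Type) where
  val : α
  time : ℕ

instance : Monad Timed where
  pure a := ⟨a, 0⟩
  bind m f := ⟨(f m.val).val, m.time + (f m.val).time⟩

namespace Timed

/-- One elementary operation: a read or write of one array entry, or one addition, comparison or
Boolean operation. -/
def op {α : Type} (a : α) : Timed α := ⟨a, 1⟩

/-- `k` elementary operations. -/
def charge (k : ℕ) : Timed Unit := ⟨(), k⟩

/-- The loop `for i = 0, …, k - 1`; the loop counter costs one step in each iteration. -/
def loop {σ : Type} : (k : ℕ) → (Fin k → σ → Timed σ) → σ → Timed σ
  | 0, _, s => pure s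
  | k + 1, body, s => do
      let s' ← loop k (fun i => body i.castSucc) s
      charge 1
      body (Fin.last k) s'

end Timed

open Timed

/-- Write one entry of a matrix. -/
def DBM.write {n : ℕ} (M : DBM n) (i j : Fin (n + 1)) (b : Bnd) : Timed (DBM n) :=
  op (Function.update M i (Function.update (M i) j b))

/-- Allocate a fresh matrix, in as many steps as it has entries. -/
def DBM.alloc (n : ℕ) : Timed (DBM n) := do
  charge ((n + 1) * (n + 1))
  pure fun _ _ => Bnd.inf

/-- Intersection of a canonical matrix with the single constraint that the difference of `a` and
`b` satisfies the bound `w`: the result is empty if the new bound closes a negative cycle;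
otherwise every entry is compared with the length of the path through the new bound. -/
def DBM.meet {n : ℕ} (M : DBM n) (a b : Fin (n + 1)) (w : Bnd) : Timed (ZoneRep n) := do
  let r ← op (M b a)
  let t ← op (w.add r)
  let e ← op (t.less Bnd.zero)
  if e then
    pure none
  else do
    let N₀ ← DBM.alloc n
    let N ← loop (n + 1) (fun i N₁ =>
      loop (n + 1) (fun j N₂ => do
        let m ← op (M i j)
        let p ← op (M i a)
        let q ← op (M b j)
        let s ← op (p.add w)
        let s' ← op (s.add q)
        let c ← op (s'.less m)
        if c then N₂.write i j s' else N₂.write i j m) N₁) N₀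
    pure (some N)

/-- `Z ∩ φ`. -/
def DBM.meetDiag {n : ℕ} (M : DBM n) (φ : Diag n) : Timed (ZoneRep n) :=
  M.meet φ.x.succ φ.y.succ (Bnd.fin φ.cmp φ.c)

/-- `Z ∩ ¬φ`: the negation of `x - y ◁ c` is the constraint `y - x ◁' -c`. -/
def DBM.meetNegDiag {n : ℕ} (M : DBM n) (φ : Diag n) : Timed (ZoneRep n) :=
  M.meet φ.y.succ φ.x.succ (Bnd.fin φ.cmp.dual (-φ.c))

/-- Whether the pair of indices `x`, `y` witnesses that `Z ≼_{LU} Z'` fails, that is,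
`(≤, -U x) ≤ Z 0 x`, `Z' y x < Z y x` and `Z' y x + (<, -L y) < Z 0 x`. -/
def luWitness {n : ℕ} (L U : Fin (n + 1) → WithBot ℕ) (M M' : DBM n) (x y : Fin (n + 1)) :
    Timed Bool := do
  let u ← op (U x)
  let l ← op (L y)
  match u, l with
  | (u : ℕ), (l : ℕ) => do
    let m₀ ← op (M 0 x)
    let p ← op (M' y x)
    let q ← op (M y x)
    let c₁ ← op (m₀.less (Bnd.fin .le (-(u : ℤ))))
    let c₂ ← op (p.less q)
    let s ← op (p.add (Bnd.fin .lt (-(l : ℤ))))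
    let c₃ ← op (s.less m₀)
    op (!c₁ && c₂ && c₃)
  | _, _ => op false

/-- The test `Z ≼_{LU} Z'` for non-empty zones given by canonical matrices, searching all pairs
of indices for a witness of failure. The bounds of the reference clock are `0`. -/
def luTest {n : ℕ} (L U : Fin n → WithBot ℕ) (M M' : DBM n) : Timed Bool :=
  loop (n + 1) (fun x ok =>
    loop (n + 1) (fun y ok' => do
      let w ← luWitness (Fin.cons 0 L) (Fin.cons 0 U) M M' x y
      op (ok' && !w)) ok) true

/-! ### The two mutually recursive procedures, as a machine with a call stack -/

/-- An activation record of the second procedure, waiting for its first recursive call: the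
remaining diagonal constraints `G' = G \ {φ}`, the picked constraint `φ`, and `Z`, `Z'`. -/
structure Frame (n : ℕ) where
  rest : List (Diag n)
  φ : Diag n
  Z : DBM n
  Z' : DBM n

/-- States of the machine. The current set of guards is given by the list of its diagonal
constraints, since its non-diagonal constraints never change. -/
inductive Config (n : ℕ)
  /-- a call `check Z ⊑_G Z'` of the first procedure -/
  | check (G : List (Diag n)) (Z Z' : ZoneRep n) (K : List (Frame n))
  /-- a call `check Z ⊑*_G Z'` of the second procedure -/
  | checkStar (G : List (Diag n)) (Z Z' : DBM n) (K : List (Frame n))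
  /-- the last line of the second procedure -/
  | lastLine (F : Frame n) (K : List (Frame n))
  /-- return of a value to the caller -/
  | ret (b : Bool) (K : List (Frame n))

/-- `Step oracle c t c'`: one transition from `c` to `c'`, which takes `t` elementary steps.
`oracle` is the test used for `Z ⊑_{G⁻} Z'`. Any diagonal constraint may be picked; finding it in
the list and removing it takes as many steps as its position. -/
inductive Step {n : ℕ} (oracle : DBM n → DBM n → Timed Bool) :
    Config n → ℕ → Config n → Prop
  /-- `if Z = ∅: return true` -/
  | leftEmpty (G Z' K) :
      Step oracle (.check G none Z' K) 1 (.ret true K)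
  /-- `if Z' = ∅: return false` -/
  | rightEmpty (G Z K) :
      Step oracle (.check G (some Z) none K) 2 (.ret false K)
  /-- `if not Z ⊑_{G⁻} Z': return false` -/
  | oracleFails (G Z Z' K) (h : (oracle Z Z').val = false) :
      Step oracle (.check G (some Z) (some Z') K) (3 + (oracle Z Z').time) (.ret false K)
  /-- `return Z ⊑*_G Z'` -/
  | oracleHolds (G Z Z' K) (h : (oracle Z Z').val = true) :
      Step oracle (.check G (some Z) (some Z') K) (3 + (oracle Z Z').time)
        (.checkStar G Z Z' K)
  /-- `if G does not contain any diagonal constraints: return true` -/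
  | noDiag (Z Z' K) :
      Step oracle (.checkStar [] Z Z' K) 1 (.ret true K)
  /-- pick `φ`; if `Z ∩ ¬φ ≠ ∅`, call `check Z ∩ ¬φ ⊑*_{G'} Z'` -/
  | pickCall (G₁ φ G₂ Z Z' K N) (h : (DBM.meetNegDiag Z φ).val = some N) :
      Step oracle (.checkStar (G₁ ++ φ :: G₂) Z Z' K)
        (G₁.length + 3 + (DBM.meetNegDiag Z φ).time)
        (.checkStar (G₁ ++ G₂) N Z' (⟨G₁ ++ G₂, φ, Z, Z'⟩ :: K))
  /-- pick `φ`; if `Z ∩ ¬φ = ∅`, go to the last line -/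
  | pickSkip (G₁ φ G₂ Z Z' K) (h : (DBM.meetNegDiag Z φ).val = none) :
      Step oracle (.checkStar (G₁ ++ φ :: G₂) Z Z' K)
        (G₁.length + 3 + (DBM.meetNegDiag Z φ).time)
        (.lastLine ⟨G₁ ++ G₂, φ, Z, Z'⟩ K)
  /-- the first recursive call returned `false`: `return false` -/
  | retFalse (F K) :
      Step oracle (.ret false (F :: K)) 1 (.ret false K)
  /-- the first recursive call returned `true`: go to the last line -/
  | retTrue (F K) :
      Step oracle (.ret true (F :: K)) 1 (.lastLine F K)
  /-- `return Z ∩ φ ⊑_{G'} Z' ∩ φ` -/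
  | lastCall (F : Frame n) (K) :
      Step oracle (.lastLine F K)
        (1 + (DBM.meetDiag F.Z F.φ).time + (DBM.meetDiag F.Z' F.φ).time)
        (.check F.rest (DBM.meetDiag F.Z F.φ).val (DBM.meetDiag F.Z' F.φ).val K)

/-- `Run oracle c t c'`: a finite sequence of transitions from `c` to `c'`, which takes `t`
elementary steps in total. -/
inductive Run {n : ℕ} (oracle : DBM n → DBM n → Timed Bool) (c : Config n) :
    ℕ → Config n → Prop
  | refl : Run oracle c 0 c
  | tail {t t' : ℕ} {c' c'' : Config n} :
      Run oracle c t c' → Step oracle c' t' c'' → Run oracle c (t + t') c''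

/-- There is no infinite sequence of transitions from `c`. -/
def Terminates {n : ℕ} (oracle : DBM n → DBM n → Timed Bool) (c : Config n) : Prop :=
  ¬ ∃ f : ℕ → Config n, f 0 = c ∧ ∀ i, ∃ t, Step oracle (f i) t (f (i + 1))

/-- Every run from `c` that cannot be continued ends by returning, from the outermost call, the
truth value of `P`. -/
def Answers {n : ℕ} (oracle : DBM n → DBM n → Timed Bool) (c : Config n) (P : Prop) : Prop :=
  ∀ t c', Run oracle c t c' → (¬ ∃ t' c'', Step oracle c' t' c'') →
    ∃ b : Bool, c' = .ret b [] ∧ (b = true ↔ P)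

/-- All runs from `c` take at most `T` elementary steps. -/
def RunsWithin {n : ℕ} (oracle : DBM n → DBM n → Timed Bool) (c : Config n) (T : ℕ) : Prop :=
  ∀ t c', Run oracle c t c' → t ≤ T

/-- `D` lists the diagonal constraints of `G`, without repetition. -/
def ListsDiags {n : ℕ} (D : List (Diag n)) (G : Finset (Atom n)) : Prop :=
  D.Nodup ∧ ∀ φ : Diag n, φ ∈ D ↔ Atom.diag φ ∈ G

/-- `oracle` decides, for non-empty zones given by canonical matrices, whether `Z R Z'`. -/
def Decides {n : ℕ} (oracle : DBM n → DBM n → Timed Bool)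
    (R : Valuation n → Valuation n → Prop) : Prop :=
  ∀ M M' : DBM n, M.Canonical → M'.Canonical →
    ((oracle M M').val = true ↔ SetSim R M.sols M'.sols)

end TimedZone

namespace TimedZone

/-! ### Bounds as lower sets of reals -/

/-! A bound is identified with the lower set of the reals that satisfy it. Tightness becomes
inclusion, which is a linear order, and addition becomes Minkowski sum, so that strict, non-strict
and absent bounds are treated alike. A canonical matrix then satisfies the triangle inequality over
a linearly ordered monoid, and such a matrix has a solution on every finite set of indices
(`PathClosed.exists_solution_on`).

All other existence statements come from adding the paths through one more vertex
(`PathClosed.tighten`). This covers intersection with a constraint and both directions of the LU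
test. From a witness pair one builds a valuation of `Z` that nothing in `Z'` simulates
(`IsLUWitness.not_setSim`). Conversely, the valuations that simulate a given `v` form a box, and
without a witness pair this box meets `Z'` (`exists_mem_sols_of_box`).

Both simulations are a base relation `R`, decided exactly by the oracle, together with preservation
of the diagonal constraints; for `GuardSim` this uses that diagonals are invariant under delay.
Splitting `Z` along a diagonal `φ` justifies the recursion (`setSim_diagSim_pick`), and correctness
follows since `Config.Holds` is invariant along transitions.

Each transition lowers the potential `Config.remainingTime` by at least its cost, which is positive.
The potential obeys s(d+1) = 2 s(d) + d + K, where K collects one oracle call, three intersections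
and a constant. Its solution is O(2^d K), without a factor d. -/

theorem mem_lowerSet_add {S T : LowerSet ℝ} {r : ℝ} :
    r ∈ S + T ↔ ∃ a ∈ S, ∃ b ∈ T, a + b = r := by
  rw [← SetLike.mem_coe, LowerSet.coe_add, Set.mem_add]
  rfl

theorem lowerSet_lt_iff {S T : LowerSet ℝ} : S < T ↔ ∃ r ∈ T, r ∉ S := by
  rw [← not_le, ← LowerSet.coe_subset_coe, Set.not_subset]
  rfl

theorem zero_le_lowerSet_iff {S : LowerSet ℝ} : 0 ≤ S ↔ (0 : ℝ) ∈ S := by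
  rw [← LowerSet.Iic_zero, LowerSet.Iic_le]

instance : IsOrderedAddMonoid (LowerSet ℝ) where
  add_le_add_left S T h R := by
    intro r hr
    have hr' : r ∈ S + R := hr
    rw [mem_lowerSet_add] at hr'
    obtain ⟨a, ha, b, hb, hab⟩ := hr'
    exact mem_lowerSet_add.2 ⟨a, h ha, b, hb, hab⟩

namespace Bnd

/-- The set of the reals that satisfy a bound. -/
def toLowerSet : Bnd → LowerSet ℝ
  | inf => ⊤
  | fin .lt c => LowerSet.Iio (c : ℝ)
  | fin .le c => LowerSet.Iic (c : ℝ)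

theorem mem_toLowerSet {b : Bnd} {r : ℝ} : r ∈ b.toLowerSet ↔ b.Sat r := by
  rcases b with _ | ⟨_ | _, c⟩ <;> simp [toLowerSet, Sat, Cmp.Holds]

theorem toLowerSet_zero : zero.toLowerSet = 0 := by
  simp [zero, toLowerSet]

theorem toLowerSet_add (b b' : Bnd) :
    (b.add b').toLowerSet = b.toLowerSet + b'.toLowerSet := by
  ext r
  rw [SetLike.mem_coe, SetLike.mem_coe, mem_lowerSet_add]
  constructor
  · intro h
    rcases b with _ | ⟨s, c⟩
    · rcases b' with _ | ⟨s', c'⟩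
      · exact ⟨r, trivial, 0, trivial, by ring⟩
      -- The summand without a bound absorbs the remainder, so the other may be any point below its
      -- constant.
      · refine ⟨r - (c' - 1), trivial, c' - 1, ?_, by ring⟩
        cases s' <;> simp [toLowerSet]
    · rcases b' with _ | ⟨s', c'⟩
      · refine ⟨c - 1, ?_, r - (c - 1), trivial, by ring⟩
        cases s <;> simp [toLowerSet]
      · have hr := mem_toLowerSet.1 h
        simp only [mem_toLowerSet]
        cases s <;> cases s' <;> simp only [add, Cmp.comb, Sat, Cmp.Holds] at hr ⊢ <;>
          push_cast at hr
        -- Both bounds are strict: the slack is shared equally.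
        · exact ⟨c + (r - c - c') / 2, by linarith, c' + (r - c - c') / 2, by linarith, by ring⟩
        · exact ⟨r - c', by linarith, c', le_rfl, by ring⟩
        · exact ⟨c, le_rfl, r - c, by linarith, by ring⟩
        · exact ⟨c, le_rfl, r - c, by linarith, by ring⟩
  · rintro ⟨x, hx, y, hy, rfl⟩
    rw [mem_toLowerSet] at *
    rcases b with _ | ⟨s, c⟩
    · trivial
    rcases b' with _ | ⟨s', c'⟩
    · trivial
    cases s <;> cases s' <;> simp only [add, Cmp.comb, Sat, Cmp.Holds] at hx hy ⊢ <;>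
      push_cast <;> linarith

theorem less_iff (b b' : Bnd) : b.less b' = true ↔ b.toLowerSet < b'.toLowerSet := by
  rcases b with _ | ⟨s, c⟩
  · simp [less, toLowerSet]
  rcases b' with _ | ⟨s', c'⟩
  · simp only [less, toLowerSet, true_iff, lt_top_iff_ne_top]
    intro h
    have : (c + 1 : ℝ) ∈ (fin s c).toLowerSet := by
      cases s <;> simp only [toLowerSet, h] <;> trivial
    cases s <;> simp [toLowerSet] at this <;> linarith
  rw [lowerSet_lt_iff]
  simp only [mem_toLowerSet]
  simp only [less, Bool.or_eq_true, decide_eq_true_eq, Bool.and_eq_true]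
  constructor
  · rintro (h | ⟨rfl, h⟩)
    · have h1 : (c : ℝ) < c' := by exact_mod_cast h
      refine ⟨(c + c') / 2, ?_, ?_⟩ <;> cases s <;> cases s' <;> simp [Sat, Cmp.Holds] <;> linarith
    · refine ⟨c, ?_⟩
      cases s <;> cases s' <;> simp [Cmp.tighter, Sat, Cmp.Holds] at h ⊢
  · rintro ⟨r, hr, hr'⟩
    by_contra hc
    push Not at hc
    have h1 : (c' : ℝ) ≤ c := by exact_mod_cast hc.1
    rcases h1.eq_or_lt with h2 | h2
    · have h3 := hc.2 (by exact_mod_cast h2.symm)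
      cases s <;> cases s' <;> simp [Cmp.tighter, Sat, Cmp.Holds] at h3 hr hr' <;> linarith
    · cases s <;> cases s' <;> simp [Sat, Cmp.Holds] at hr hr' <;> linarith

theorem less_eq_false_iff (b b' : Bnd) :
    b.less b' = false ↔ b'.toLowerSet ≤ b.toLowerSet := by
  rw [← Bool.not_eq_true, less_iff, not_lt]

/-- No bound expresses minus infinity; hence an unconstrained side can always compensate for a
matrix entry in the box argument. -/
theorem nonempty_toLowerSet (b : Bnd) : ∃ r, r ∈ b.toLowerSet := by
  rcases b with _ | ⟨_ | _, c⟩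
  · exact ⟨0, trivial⟩
  · exact ⟨c - 1, by simp [toLowerSet]⟩
  · exact ⟨c, by simp [toLowerSet]⟩

end Bnd

/-! ### Closed matrices over an ordered monoid -/

/-- Matrices closed under shortest paths, without negative cycles. -/
structure PathClosed {ι M : Type*} [AddCommMonoid M] [LinearOrder M] (A : ι → ι → M) : Prop where
  diag : ∀ i, 0 ≤ A i i
  triangle : ∀ i j k, A i j ≤ A i k + A k j

/-- Tightening a closed matrix by the paths through one more vertex gives a closed matrix. -/
theorem PathClosed.tighten {ι M : Type*} [AddCommMonoid M] [LinearOrder M] [IsOrderedAddMonoid M]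
    {A : ι → ι → M} (hA : PathClosed A) {P Q : ι → M} (hP : ∀ i k, P i ≤ A i k + P k)
    (hQ : ∀ k j, Q j ≤ Q k + A k j) (hPQ : ∀ k, 0 ≤ P k + Q k) :
    PathClosed fun i j => min (A i j) (P i + Q j) where
  diag i := le_min (hA.diag i) (hPQ i)
  triangle i j k := by
    rcases min_choice (A i k) (P i + Q k) with h | h <;>
      rcases min_choice (A k j) (P k + Q j) with h' | h' <;> rw [h, h']
    · exact (min_le_left _ _).trans (hA.triangle i j k)
    · refine (min_le_right _ _).trans ?_
      rw [← add_assoc]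
      exact add_le_add_left (hP i k) _
    · refine (min_le_right _ _).trans ?_
      rw [add_assoc]
      exact add_le_add_right (hQ k j) _
    · refine (min_le_right _ _).trans ?_
      -- A path through the new vertex twice contains the cycle `P k + Q k`, which is nonnegative
      -- and can be dropped.
      calc P i + Q j = 0 + (P i + Q j) := (zero_add _).symm
        _ ≤ (P k + Q k) + (P i + Q j) := add_le_add_left (hPQ k) _
        _ = _ := by abel

/-! ### Solutions of closed matrices -/

/-- Helly's theorem on the line, for half-lines. -/
theorem exists_forall_of_pairwise {ι : Type*} (S : Finset ι) {p q : ι → ℝ → Prop}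
    (hp : ∀ i r r', r ≤ r' → p i r → p i r') (hq : ∀ i r r', r' ≤ r → q i r → q i r')
    (h : ∀ i ∈ S, ∀ j ∈ S, ∃ r, p i r ∧ q j r) : ∃ r, ∀ i ∈ S, p i r ∧ q i r := by
  rcases S.eq_empty_or_nonempty with rfl | hS
  · exact ⟨0, by simp⟩
  choose! f hf using h
  -- Each inner infimum still satisfies `p i`, as it is attained, and the outer supremum is the
  -- largest of these lower limits. It equals the infimum for some `k`, hence is at most `f k i`,
  -- which satisfies `q i`.
  refine ⟨S.sup' hS fun i => S.inf' hS fun j => f i j, fun i hi => ⟨?_, ?_⟩⟩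
  · obtain ⟨j, hj, hj'⟩ := S.exists_mem_eq_inf' hS fun j => f i j
    refine hp i _ _ ?_ (hf i hi j hj).1
    rw [← hj']
    exact S.le_sup' (fun i => S.inf' hS fun j => f i j) hi
  · obtain ⟨k, hk, hk'⟩ := S.exists_mem_eq_sup' hS fun i => S.inf' hS fun j => f i j
    refine hq i _ _ ?_ (hf k hk i hi).2
    rw [hk']
    exact S.inf'_le _ hi

/-- Values are assigned one index at a time. Those already fixed confine the new one to half-lines,
and the triangle inequality says exactly that an upward and a downward half-line always meet;
Helly's theorem on the line concludes. -/
theorem PathClosed.exists_solution_on {ι : Type*} [DecidableEq ι] {A : ι → ι → LowerSet ℝ}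
    (hA : PathClosed A) (S : Finset ι) :
    ∃ v : ι → ℝ, ∀ i ∈ S, ∀ j ∈ S, v i - v j ∈ A i j := by
  induction S using Finset.induction_on with
  | empty => exact ⟨0, by simp⟩
  | insert k S hk ih =>
    obtain ⟨v, hv⟩ := ih
    obtain ⟨r, hr⟩ := exists_forall_of_pairwise S
      (p := fun i r => v i - r ∈ A i k) (q := fun j r => r - v j ∈ A k j)
      (fun i r r' h h' => (A i k).lower (by linarith) h')
      (fun i r r' h h' => (A k i).lower (by linarith) h')
      (fun i hi j hj => by
        obtain ⟨a, ha, b, hb, hab⟩ := mem_lowerSet_add.1 (hA.triangle i j k (hv i hi j hj))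
        exact ⟨v i - a, by simpa using ha, by rwa [show v i - a - v j = b by linarith]⟩)
    have hne : ∀ i ∈ S, i ≠ k := fun i hi h => hk (h ▸ hi)
    refine ⟨Function.update v k r, fun i hi j hj => ?_⟩
    rw [Finset.mem_insert] at hi hj
    rcases hi with rfl | hi <;> rcases hj with rfl | hj
    · rw [sub_self]
      exact zero_le_lowerSet_iff.1 (hA.diag _)
    · rw [Function.update_self, Function.update_of_ne (hne j hj)]
      exact (hr j hj).2
    · rw [Function.update_self, Function.update_of_ne (hne i hi)]
      exact (hr i hi).1
    · rw [Function.update_of_ne (hne i hi), Function.update_of_ne (hne j hj)]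
      exact hv i hi j hj

@[simp] theorem Valuation.ext_zero {n : ℕ} (v : Valuation n) : v.ext 0 = 0 := rfl

@[simp] theorem Valuation.ext_succ {n : ℕ} (v : Valuation n) (x : Fin n) : v.ext x.succ = v x :=
  rfl

theorem Valuation.ext_nonneg {n : ℕ} (v : Valuation n) (i : Fin (n + 1)) : 0 ≤ v.ext i := by
  induction i using Fin.cases with
  | zero => simp
  | succ x => simp

/-- Only differences matter, so a solution may be translated to vanish at the reference clock; `h0`
then makes the clocks nonnegative. -/
theorem PathClosed.exists_valuation {n : ℕ} {A : Fin (n + 1) → Fin (n + 1) → LowerSet ℝ}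
    (hA : PathClosed A) (h0 : ∀ j, A 0 j ≤ 0) :
    ∃ v : Valuation n, ∀ i j, v.ext i - v.ext j ∈ A i j := by
  obtain ⟨v, hv⟩ := hA.exists_solution_on Finset.univ
  simp only [Finset.mem_univ, true_imp_iff] at hv
  have hv0 : ∀ j, 0 ≤ v j - v 0 := fun j => by
    have h : v 0 - v j ∈ LowerSet.Iic (0 : ℝ) := h0 j (hv 0 j)
    rw [LowerSet.mem_Iic_iff] at h
    linarith
  refine ⟨fun x => ⟨v x.succ - v 0, hv0 _⟩, fun i j => ?_⟩
  have hext : ∀ i, Valuation.ext (fun x : Fin n => (⟨v x.succ - v 0, hv0 _⟩ : ℝ≥0)) i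
      = v i - v 0 := fun i => by
    induction i using Fin.cases with
    | zero => exact (sub_self _).symm
    | succ x => rfl
  rw [hext, hext, sub_sub_sub_cancel_right]
  exact hv i j

/-! ### Canonical difference bound matrices -/

namespace DBM

variable {n : ℕ}

/-- The entries of a matrix, as lower sets of reals. -/
def sets (M : DBM n) (i j : Fin (n + 1)) : LowerSet ℝ := (M i j).toLowerSet

theorem mem_sols_iff {M : DBM n} {v : Valuation n} :
    v ∈ M.sols ↔ ∀ i j, v.ext i - v.ext j ∈ M.sets i j := by
  simp only [sets, Bnd.mem_toLowerSet]
  rfl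

theorem Canonical.sets_diag {M : DBM n} (hM : M.Canonical) (i) : M.sets i i = 0 := by
  rw [sets, hM.diag, Bnd.toLowerSet_zero]

theorem Canonical.pathClosed {M : DBM n} (hM : M.Canonical) : PathClosed M.sets where
  diag i := (hM.sets_diag i).ge
  triangle i j k := by
    have := hM.triangle i j k
    rwa [Bnd.less_eq_false_iff, Bnd.toLowerSet_add] at this

theorem Canonical.sets_zero_le {M : DBM n} (hM : M.Canonical) (j) : M.sets 0 j ≤ 0 := by
  have := hM.nonneg j
  rwa [Bnd.less_eq_false_iff, Bnd.toLowerSet_zero] at this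

theorem Canonical.sols_nonempty {M : DBM n} (hM : M.Canonical) : M.sols.Nonempty := by
  obtain ⟨v, hv⟩ := hM.pathClosed.exists_valuation hM.sets_zero_le
  exact ⟨v, mem_sols_iff.2 hv⟩

end DBM

/-! ### The simulation test on matrices -/

theorem natCast_withBot_inj {a b : ℕ} : (a : WithBot ℕ) = b ↔ a = b :=
  WithBot.coe_inj

theorem mem_left_of_mem_min {S T : LowerSet ℝ} {r : ℝ} (h : r ∈ min S T) : r ∈ S :=
  (min_le_left S T : _ ≤ S) h

theorem mem_right_of_mem_min {S T : LowerSet ℝ} {r : ℝ} (h : r ∈ min S T) : r ∈ T :=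
  (min_le_right S T : _ ≤ T) h

theorem belowReal_iff {b : WithBot ℕ} {r : ℝ≥0} :
    BelowReal b r ↔ ∀ c : ℕ, b = c → (c : ℝ) < r := by
  induction b using WithBot.recBotCoe with
  | bot => simp [BelowReal]
  | coe c =>
    simp only [BelowReal, WithBot.map_coe, WithBot.coe_lt_coe]
    constructor
    · intro h c' hc
      rw [← natCast_withBot_inj.1 hc]
      exact_mod_cast h
    · intro h
      exact_mod_cast h c rfl

/-- The reference clock has the same value in both valuations, so including it with bounds `0`
demands nothing. -/
theorem luSim_iff {n : ℕ} {L U : Fin n → WithBot ℕ} {v v' : Valuation n} :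
    LUSim L U v v' ↔ ∀ i : Fin (n + 1),
      (∀ l : ℕ, (Fin.cons 0 L : Fin (n + 1) → WithBot ℕ) i = l → v'.ext i < v.ext i →
        (l : ℝ) < v'.ext i) ∧
      (∀ u : ℕ, (Fin.cons 0 U : Fin (n + 1) → WithBot ℕ) i = u → v.ext i < v'.ext i →
        (u : ℝ) < v.ext i) := by
  rw [Fin.forall_fin_succ]
  simp only [Valuation.ext_zero, lt_irrefl, false_imp_iff, implies_true, true_and,
    Valuation.ext_succ, Fin.cons_succ, NNReal.coe_lt_coe, LUSim, belowReal_iff]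
  exact forall_congr' fun x => and_congr ⟨fun h l hl hv => h hv l hl, fun h hv l hl => h l hl hv⟩
    ⟨fun h l hl hv => h hv l hl, fun h hv l hl => h l hl hv⟩

/-- The pair of indices `x`, `y` witnesses that `Z ≼_{LU} Z'` fails. -/
def IsLUWitness {n : ℕ} (L U : Fin (n + 1) → WithBot ℕ) (M M' : DBM n) (x y : Fin (n + 1)) :
    Prop :=
  ∃ u l : ℕ, U x = u ∧ L y = l ∧ LowerSet.Iic (-(u : ℝ)) ≤ M.sets 0 x ∧
    M'.sets y x < M.sets y x ∧ M'.sets y x + LowerSet.Iio (-(l : ℝ)) < M.sets 0 x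

theorem luWitness_val {n : ℕ} (L U : Fin (n + 1) → WithBot ℕ) (M M' : DBM n)
    (x y : Fin (n + 1)) :
    (luWitness L U M M' x y).val = true ↔ IsLUWitness L U M M' x y := by
  unfold luWitness IsLUWitness
  generalize U x = u
  generalize L y = l
  cases u with
  | bot =>
    refine iff_of_false (by simp [bind, Timed.op]) ?_
    rintro ⟨_, _, h, _⟩
    exact WithBot.bot_ne_coe h
  | coe u =>
    cases l with
    | bot =>
      refine iff_of_false (by simp [bind, Timed.op]) ?_
      rintro ⟨_, _, _, h, _⟩
      exact WithBot.bot_ne_coe h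
    | coe l =>
      have h1 : (LowerSet.Iic (-(u : ℝ))) = (Bnd.fin .le (-(u : ℤ))).toLowerSet := by
        simp [Bnd.toLowerSet]
      have h2 : (LowerSet.Iio (-(l : ℝ))) = (Bnd.fin .lt (-(l : ℤ))).toLowerSet := by
        simp [Bnd.toLowerSet]
      have h3 : (∃ u' l' : ℕ, (u : WithBot ℕ) = u' ∧ (l : WithBot ℕ) = l' ∧
          LowerSet.Iic (-(u' : ℝ)) ≤ M.sets 0 x ∧ M'.sets y x < M.sets y x ∧
          M'.sets y x + LowerSet.Iio (-(l' : ℝ)) < M.sets 0 x) ↔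
          LowerSet.Iic (-(u : ℝ)) ≤ M.sets 0 x ∧ M'.sets y x < M.sets y x ∧
          M'.sets y x + LowerSet.Iio (-(l : ℝ)) < M.sets 0 x := by
        constructor
        · rintro ⟨_, _, hu, hl, h⟩
          rw [natCast_withBot_inj] at hu hl
          subst hu hl
          exact h
        · intro h
          exact ⟨u, l, rfl, rfl, h⟩
      refine Iff.trans ?_ h3.symm
      rw [h1, h2]
      simp only [DBM.sets, ← Bnd.toLowerSet_add, ← Bnd.less_iff, ← Bnd.less_eq_false_iff]
      simp [bind, Timed.op, and_assoc]

/-- Take `r` allowed by `M y x` but not by `M' y x`, and `s` allowed by `M 0 x` but not by the third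
sum of the witness. Some `v` in the left zone has y - x ≥ `r` and x ≤ min(`u`, -`s`). A simulating
`v'` cannot increase x, hence must decrease y, hence keeps y above `l`; then -x at `v'` lies in the
sum that excludes `s`, although it is at least `s`. -/
theorem IsLUWitness.not_setSim {n : ℕ} {L U : Fin n → WithBot ℕ} {M M' : DBM n}
    (hM : M.Canonical) {x y : Fin (n + 1)}
    (h : IsLUWitness (Fin.cons 0 L) (Fin.cons 0 U) M M' x y) :
    ¬ SetSim (LUSim L U) M.sols M'.sols := by
  obtain ⟨u, l, hu, hl, h1, h2, h3⟩ := h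
  obtain ⟨r, hr, hr'⟩ := lowerSet_lt_iff.1 h2
  obtain ⟨s, hs, hs'⟩ := lowerSet_lt_iff.1 h3
  have hu0 : -(u : ℝ) ∈ M.sets 0 x := h1 (LowerSet.mem_Iic_iff.2 le_rfl)
  -- Both new constraints are edges leaving `x`, one to the reference and one to `y`, so a single
  -- tightening through `x` handles them; `Q` takes the better edge.
  obtain ⟨v, hv⟩ := (hM.pathClosed.tighten (P := fun i => M.sets i x)
    (Q := fun j => min (LowerSet.Iic (min (u : ℝ) (-s)) + M.sets 0 j)
      (LowerSet.Iic (-r) + M.sets y j))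
    (fun i k => hM.pathClosed.triangle i x k)
    (fun k j => by
      rcases min_choice (LowerSet.Iic (min (u : ℝ) (-s)) + M.sets 0 k)
        (LowerSet.Iic (-r) + M.sets y k) with h | h <;> rw [h, add_assoc]
      · exact (min_le_left _ _).trans (add_le_add_right (hM.pathClosed.triangle _ _ _) _)
      · exact (min_le_right _ _).trans (add_le_add_right (hM.pathClosed.triangle _ _ _) _))
    (fun k => by
      rcases min_choice (LowerSet.Iic (min (u : ℝ) (-s)) + M.sets 0 k)
        (LowerSet.Iic (-r) + M.sets y k) with h | h <;> rw [h, add_left_comm, add_comm (M.sets k x)]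
      · refine le_trans ?_ (add_le_add_right (hM.pathClosed.triangle 0 x k) _)
        rw [zero_le_lowerSet_iff, mem_lowerSet_add]
        rcases min_choice (u : ℝ) (-s) with h | h <;> rw [h]
        · exact ⟨u, LowerSet.mem_Iic_iff.2 le_rfl, _, hu0, by ring⟩
        · exact ⟨-s, LowerSet.mem_Iic_iff.2 le_rfl, _, hs, by ring⟩
      · refine le_trans ?_ (add_le_add_right (hM.pathClosed.triangle y x k) _)
        rw [zero_le_lowerSet_iff, mem_lowerSet_add]
        exact ⟨-r, LowerSet.mem_Iic_iff.2 le_rfl, _, hr, by ring⟩)).exists_valuation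
    (fun j => (min_le_left _ _).trans (hM.sets_zero_le j))
  have hx0 : v.ext x ≤ min (u : ℝ) (-s) := by
    have := add_le_add_right (min_le_left _ _) (M.sets x x) (mem_right_of_mem_min (hv x 0))
    rw [hM.sets_diag, hM.sets_diag, zero_add, add_zero, SetLike.mem_coe, LowerSet.mem_Iic_iff] at this
    simpa using this
  have hxy : r ≤ v.ext y - v.ext x := by
    have := add_le_add_right (min_le_right _ _) (M.sets x x) (mem_right_of_mem_min (hv x y))
    rw [hM.sets_diag, hM.sets_diag, zero_add, add_zero, SetLike.mem_coe, LowerSet.mem_Iic_iff] at this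
    linarith
  intro hsim
  obtain ⟨v', hv', hlu⟩ := hsim v (DBM.mem_sols_iff.2 fun i j => mem_left_of_mem_min (hv i j))
  rw [luSim_iff] at hlu
  rw [DBM.mem_sols_iff] at hv'
  have hx : v'.ext x ≤ v.ext x := by
    by_contra hc
    have h4 := (hlu x).2 u hu (lt_of_not_ge hc)
    exact absurd (hx0.trans (min_le_left _ _)) (not_le.2 h4)
  have hy : v'.ext y < v.ext y := by
    by_contra hc
    refine hr' ((M'.sets y x).lower ?_ (hv' y x))
    linarith
  have h5 := (hlu y).1 l hl hy
  refine hs' ((M'.sets y x + LowerSet.Iio (-(l : ℝ))).lower (a := -v'.ext x) ?_ ?_)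
  · linarith [hx0.trans (min_le_right _ _)]
  · exact mem_lowerSet_add.2 ⟨_, hv' y x, -v'.ext y, LowerSet.mem_Iio_iff.2 (by linarith), by ring⟩

/-- The box constraints are edges to and from a second copy of the reference clock, and `h` says
that no cycle through it is negative. `P` and `Q` are the shortest paths into and out of this copy.
-/
theorem exists_mem_sols_of_box {n : ℕ} {M : DBM n} (hM : M.Canonical)
    {u l : Fin (n + 1) → LowerSet ℝ} (hu : u 0 ≤ 0) (hl : l 0 ≤ 0)
    (h : ∀ x y, 0 ≤ M.sets y x + u x + l y) :
    ∃ v ∈ M.sols, ∀ i, v.ext i ∈ u i ∧ -v.ext i ∈ l i := by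
  have hc := hM.pathClosed
  have hP : ∀ i, ∃ x, M.sets i x + u x = ⨅ x, (M.sets i x + u x) := fun i =>
    exists_eq_ciInf_of_finite
  have hQ : ∀ j, ∃ y, l y + M.sets y j = ⨅ y, (l y + M.sets y j) := fun j =>
    exists_eq_ciInf_of_finite
  have hPle : ∀ i, (⨅ x, (M.sets i x + u x)) ≤ u i := fun i =>
    (iInf_le _ i).trans (by rw [hM.sets_diag, zero_add])
  have hQle : ∀ j, (⨅ y, (l y + M.sets y j)) ≤ l j := fun i =>
    (iInf_le _ i).trans (by rw [hM.sets_diag, add_zero])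
  obtain ⟨v, hv⟩ := (hc.tighten (P := fun i => ⨅ x, (M.sets i x + u x))
    (Q := fun j => ⨅ y, (l y + M.sets y j))
    (fun i k => by
      obtain ⟨x, hx⟩ := hP k
      rw [← hx, ← add_assoc]
      exact (iInf_le _ x).trans (add_le_add_left (hc.triangle _ _ _) _))
    (fun k j => by
      obtain ⟨y, hy⟩ := hQ k
      rw [← hy, add_assoc]
      exact (iInf_le _ y).trans (add_le_add_right (hc.triangle _ _ _) _))
    (fun k => by
      obtain ⟨x, hx⟩ := hP k
      obtain ⟨y, hy⟩ := hQ k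
      rw [← hx, ← hy]
      calc 0 ≤ M.sets y x + u x + l y := h x y
        _ ≤ (M.sets y k + M.sets k x) + u x + l y := by gcongr; exact hc.triangle _ _ _
        _ = _ := by abel)).exists_valuation
    (fun j => (min_le_left _ _).trans (hM.sets_zero_le j))
  refine ⟨v, DBM.mem_sols_iff.2 fun i j => mem_left_of_mem_min (hv i j), fun i => ⟨?_, ?_⟩⟩
  -- Tightening only controls sums `u i + l j`; since `u 0` and `l 0` are at most `0`, pairing with
  -- the reference clock separates the two sides.
  · have h1 := ((min_le_right _ _).trans (add_le_add (hPle i) ((hQle 0).trans hl))) (hv i 0)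
    rw [add_zero] at h1
    simpa using h1
  · have h1 := ((min_le_right _ _).trans (add_le_add ((hPle 0).trans hu) (hQle i))) (hv 0 i)
    rw [zero_add] at h1
    simpa using h1

theorem setSim_of_forall_not_isLUWitness {n : ℕ} {L U : Fin n → WithBot ℕ} {M M' : DBM n}
    (hM' : M'.Canonical)
    (h : ∀ x y, ¬ IsLUWitness (Fin.cons 0 L) (Fin.cons 0 U) M M' x y) :
    SetSim (LUSim L U) M.sols M'.sols := by
  intro v hv
  rw [DBM.mem_sols_iff] at hv
  -- These sets describe the box of the valuations that simulate `v`: an upper limit only where `v`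
  -- is at most `U`, and a lower limit that is either the value of `v` or strict at `L`.
  let u : Fin (n + 1) → LowerSet ℝ := fun x =>
    ⟨{r | ∀ u : ℕ, (Fin.cons 0 U : Fin (n + 1) → WithBot ℕ) x = u → v.ext x ≤ u → r ≤ v.ext x},
      fun r r' hr h u hu hv => hr.trans (h u hu hv)⟩
  let l : Fin (n + 1) → LowerSet ℝ := fun y =>
    ⟨{r | ∀ l : ℕ, (Fin.cons 0 L : Fin (n + 1) → WithBot ℕ) y = l → r ≤ -v.ext y ∨ r < -l},
      fun r r' hr h l hl => (h l hl).imp hr.trans hr.trans_lt⟩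
  obtain ⟨v', hv', hb⟩ := exists_mem_sols_of_box hM' (u := u) (l := l)
    (fun r hr => by
      exact LowerSet.mem_Iic_iff.2 ((show _ from hr) 0 rfl (by simp)))
    (fun r hr => by
      have := (show _ from hr) 0 rfl
      simp only [Valuation.ext_zero, neg_zero, Nat.cast_zero] at this
      exact this.elim id le_of_lt)
    (fun x y => by
      rw [zero_le_lowerSet_iff]
      suffices ∃ a ∈ M'.sets y x, ∃ b ∈ u x, ∃ c ∈ l y, a + b + c = 0 by
        obtain ⟨a, ha, b, hb, c, hc, h0⟩ := this
        exact mem_lowerSet_add.2 ⟨_, mem_lowerSet_add.2 ⟨a, ha, b, hb, rfl⟩, c, hc, h0⟩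
      obtain ⟨a, ha⟩ := Bnd.nonempty_toLowerSet (M' y x)
      by_cases hu : ∃ u : ℕ, (Fin.cons 0 U : Fin (n + 1) → WithBot ℕ) x = u ∧ v.ext x ≤ u
      swap
      · refine ⟨a, ha, -a + v.ext y, fun u h1 h2 => (hu ⟨u, h1, h2⟩).elim, -v.ext y,
          fun l _ => Or.inl le_rfl, by ring⟩
      obtain ⟨u', hu, hu'⟩ := hu
      have hvx : v.ext x ∈ u x := fun _ _ _ => le_rfl
      by_cases hl : ∃ l : ℕ, (Fin.cons 0 L : Fin (n + 1) → WithBot ℕ) y = l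
      swap
      · exact ⟨a, ha, v.ext x, hvx, -a - v.ext x, fun l h1 => (hl ⟨l, h1⟩).elim, by ring⟩
      obtain ⟨l', hl⟩ := hl
      have h1 : LowerSet.Iic (-(u' : ℝ)) ≤ M.sets 0 x := by
        rw [LowerSet.Iic_le]
        exact (M.sets 0 x).lower (by simpa using hu') (hv 0 x)
      by_cases h2 : M'.sets y x < M.sets y x
      swap
      -- Here the pair of values of `v` itself is admissible.
      · exact ⟨_, not_lt.1 h2 (hv y x), v.ext x, hvx, -v.ext y, fun l _ => Or.inl le_rfl,
          by ring⟩
      have h3 := not_lt.1 fun h3 => h x y ⟨u', l', hu, hl, h1, h2, h3⟩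
      -- Since the third condition fails, -x at `v` splits into an admissible difference and the
      -- negative of a value of y above `L y`.
      obtain ⟨a, ha, c, hc, hac⟩ := mem_lowerSet_add.1 (h3 (hv 0 x))
      refine ⟨a, ha, v.ext x, hvx, c, fun l h4 => Or.inr ?_, ?_⟩
      · rw [hl, natCast_withBot_inj] at h4
        rw [← h4]
        exact hc
      · rw [Valuation.ext_zero] at hac
        linarith)
  refine ⟨v', hv', luSim_iff.2 fun i => ⟨fun l h1 h2 => ?_, fun u h1 h2 => ?_⟩⟩
  · rcases (hb i).2 l h1 with h3 | h3 <;> linarith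
  · by_contra h3
    exact absurd ((hb i).1 u h1 (not_lt.1 h3)) (not_le.2 h2)

/-! ### Loops -/

namespace Timed

variable {α β : Type}

@[simp] theorem val_bind (m : Timed α) (f : α → Timed β) : (m >>= f).val = (f m.val).val := rfl

@[simp] theorem time_bind (m : Timed α) (f : α → Timed β) :
    (m >>= f).time = m.time + (f m.val).time := rfl

@[simp] theorem val_pure (a : α) : (pure a : Timed α).val = a := rfl

@[simp] theorem time_pure (a : α) : (pure a : Timed α).time = 0 := rfl

@[simp] theorem val_op (a : α) : (op a).val = a := rfl

@[simp] theorem time_op (a : α) : (op a).time = 1 := rfl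

@[simp] theorem time_charge (k : ℕ) : (charge k).time = k := rfl

/-- The invariant rule for loops. -/
theorem loop_val_induction {k : ℕ} {body : Fin k → α → Timed α} {s : α}
    (motive : ℕ → α → Prop) (zero : motive 0 s)
    (succ : ∀ (i : Fin k) t, motive i t → motive (i + 1) (body i t).val) :
    motive k (loop k body s).val := by
  induction k with
  | zero => exact zero
  | succ k ih => exact succ (Fin.last k) _ (ih fun i t h => succ i.castSucc t h)

theorem loop_time_le {k : ℕ} {body : Fin k → α → Timed α} {s : α} {T : ℕ}
    (h : ∀ i t, (body i t).time ≤ T) : (loop k body s).time ≤ k * (T + 1) := by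
  induction k with
  | zero => exact Nat.zero_le _
  | succ k ih =>
    have h1 := ih (body := fun i => body i.castSucc) fun i t => h i.castSucc t
    have h2 := h (Fin.last k) (loop k (fun i => body i.castSucc) s).val
    simp only [loop, time_bind, time_charge]
    rw [Nat.succ_mul]
    omega

theorem loop_val_bool {k : ℕ} {body : Fin k → Bool → Timed Bool} {s : Bool} {P : Fin k → Prop}
    (h : ∀ i t, (body i t).val = true ↔ t = true ∧ P i) :
    (loop k body s).val = true ↔ s = true ∧ ∀ i, P i := by
  have := loop_val_induction (body := body) (s := s)
    (fun m t => t = true ↔ s = true ∧ ∀ i : Fin k, (i : ℕ) < m → P i) (by simp)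
    (fun i t ht => by
      rw [h, ht, and_assoc]
      refine and_congr_right fun _ => ⟨?_, fun H => ⟨fun j hj => H j (by omega), H i (by omega)⟩⟩
      rintro ⟨h1, h2⟩ j hj
      rcases Nat.lt_succ_iff_lt_or_eq.1 hj with h3 | h3
      · exact h1 j h3
      · rwa [Fin.ext h3])
  simpa using this

theorem loop_val_update {k : ℕ} {body : Fin k → (Fin k → α) → Timed (Fin k → α)} {s g : Fin k → α}
    (h : ∀ i t, (body i t).val i = g i ∧ ∀ j ≠ i, (body i t).val j = t j) :
    (loop k body s).val = g := by
  have := loop_val_induction (body := body) (s := s)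
    (fun m t => ∀ i : Fin k, (i : ℕ) < m → t i = g i) (by simp)
    (fun i t ht j hj => by
      by_cases hji : j = i
      · rw [hji, (h i t).1]
      · rw [(h i t).2 j hji]
        exact ht j (by have := Fin.val_ne_of_ne hji; omega))
  exact funext fun i => this i i.2

end Timed

open Timed

/-! ### Intersection with a constraint -/

namespace DBM

variable {n : ℕ}

/-- The minimum of an entry and of the path through the new bound. -/
def relax (M : DBM n) (a b : Fin (n + 1)) (w : Bnd) : DBM n := fun i j =>
  if (((M i a).add w).add (M b j)).less (M i j) then ((M i a).add w).add (M b j) else M i j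

theorem loop_val_row {m : ℕ} (body : Fin m → DBM n → Timed (DBM n)) (e : Fin m → Fin (n + 1))
    (i : Fin (n + 1)) (g : Fin (n + 1) → Bnd)
    (h : ∀ j N, (body j N).val = Function.update N i (Function.update (N i) (e j) (g (e j))))
    (N : DBM n) :
    (∀ j, (loop m body N).val i (e j) = g (e j)) ∧
      ∀ i' ≠ i, (loop m body N).val i' = N i' := by
  have := loop_val_induction (body := body) (s := N)
    (fun k N' => (∀ j : Fin m, (j : ℕ) < k → N' i (e j) = g (e j)) ∧ ∀ i' ≠ i, N' i' = N i')
    (by simp)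
    (fun j N' hN' => by
      rw [h]
      refine ⟨fun j' hj' => ?_, fun i' hi' => ?_⟩
      · rw [Function.update_self]
        by_cases hj : e j' = e j
        · rw [hj, Function.update_self]
        · rw [Function.update_of_ne hj]
          have : j' ≠ j := fun h => hj (h ▸ rfl)
          exact hN'.1 j' (by have := Fin.val_ne_of_ne this; omega)
      · rw [Function.update_of_ne hi']
        exact hN'.2 i' hi')
  exact ⟨fun j => this.1 j j.2, this.2⟩

theorem meet_val (M : DBM n) (a b : Fin (n + 1)) (w : Bnd) :
    (M.meet a b w).val =
      if (w.add (M b a)).less Bnd.zero then none else some (M.relax a b w) := by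
  change (if (w.add (M b a)).less Bnd.zero then pure none else _ : Timed (ZoneRep n)).val = _
  split_ifs with h
  · rfl
  · simp only [val_bind, val_pure, Option.some.injEq]
    refine loop_val_update fun i N => ?_
    obtain ⟨h1, h2⟩ := loop_val_row (m := n + 1) (fun j N₂ => do
        let m ← op (M i j)
        let p ← op (M i a)
        let q ← op (M b j)
        let s ← op (p.add w)
        let s' ← op (s.add q)
        let c ← op (s'.less m)
        if c then N₂.write i j s' else N₂.write i j m) id i (M.relax a b w i) (fun j N₂ => by
          change (if (((M i a).add w).add (M b j)).less (M i j) then N₂.write i j _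
            else N₂.write i j _ : Timed (DBM n)).val = _
          simp only [relax, id]
          split_ifs <;> rfl) N
    exact ⟨funext h1, h2⟩

theorem meet_time_le (M : DBM n) (a b : Fin (n + 1)) (w : Bnd) :
    (M.meet a b w).time ≤ 3 + (n + 1) * (n + 1) + (n + 1) * ((n + 1) * 8 + 1) := by
  change 1 + (1 + (1 + (if (w.add (M b a)).less Bnd.zero then pure none else _ :
    Timed (ZoneRep n)).time)) ≤ _
  split_ifs with h
  · simp only [time_pure]
    omega
  · simp only [time_bind, time_pure, alloc, time_charge]
    have := loop_time_le (k := n + 1) (s := (alloc n).val) (T := (n + 1) * 8)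
      (body := fun i N₁ => loop (n + 1) (fun j N₂ => do
        let m ← op (M i j)
        let p ← op (M i a)
        let q ← op (M b j)
        let s ← op (p.add w)
        let s' ← op (s.add q)
        let c ← op (s'.less m)
        if c then DBM.write N₂ i j s' else DBM.write N₂ i j m) N₁)
      -- Three reads, two additions, one comparison and one write.
      (fun i N₁ => loop_time_le (T := 7) fun j N₂ => by
        change 1 + (1 + (1 + (1 + (1 + (1 +
          (if (((M i a).add w).add (M b j)).less (M i j) then DBM.write N₂ i j _
            else DBM.write N₂ i j _ : Timed (DBM n)).time))))) ≤ 7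
        split_ifs <;> simp [write])
    simp only [alloc, val_bind, val_pure] at this ⊢
    omega

theorem sets_relax (M : DBM n) (a b : Fin (n + 1)) (w : Bnd) (i j) :
    (M.relax a b w).sets i j =
      min (M.sets i j) ((M.sets i a + w.toLowerSet) + M.sets b j) := by
  simp only [sets, relax]
  split_ifs with h
  · rw [Bnd.less_iff] at h
    simp only [Bnd.toLowerSet_add] at h ⊢
    exact (min_eq_right h.le).symm
  · rw [Bool.not_eq_true, Bnd.less_eq_false_iff] at h
    simp only [Bnd.toLowerSet_add] at h ⊢
    exact (min_eq_left h).symm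

/-- An instance of `PathClosed.tighten`: paths enter through `a`, take the new edge and leave from
`b`. Nonnegativity of the cycle formed by `w` and `M b a` extends to cycles through any `k` by the
triangle inequality. -/
theorem Canonical.relax {M : DBM n} (hM : M.Canonical) {a b : Fin (n + 1)} {w : Bnd}
    (h : (w.add (M b a)).less Bnd.zero = false) : (M.relax a b w).Canonical := by
  have hc := hM.pathClosed
  rw [Bnd.less_eq_false_iff, Bnd.toLowerSet_zero, Bnd.toLowerSet_add] at h
  have key : ∀ k, 0 ≤ (M.sets k a + w.toLowerSet) + M.sets b k := fun k => by
    rw [add_comm (M.sets k a), add_assoc, add_comm (M.sets k a)]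
    exact h.trans (add_le_add_right (hc.triangle b a k) _)
  have hN := hc.tighten (P := fun i => M.sets i a + w.toLowerSet) (Q := fun j => M.sets b j)
    (fun i k => by
      rw [← add_assoc]
      exact add_le_add_left (hc.triangle _ _ _) _) (fun k j => hc.triangle _ _ _) key
  simp only [← sets_relax] at hN
  refine ⟨fun i => ?_, fun i j k => ?_, fun j => ?_⟩
  -- The diagonal must remain literally `Bnd.zero`; it does because an entry is replaced only by a
  -- strictly tighter one.
  · have h1 : (((M i a).add w).add (M b i)).less (M i i) = false := by
      rw [Bnd.less_eq_false_iff, Bnd.toLowerSet_add, Bnd.toLowerSet_add]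
      exact (hM.sets_diag i).le.trans (key i)
    rw [DBM.relax, h1, if_neg Bool.false_ne_true, hM.diag]
  · rw [Bnd.less_eq_false_iff, Bnd.toLowerSet_add]
    exact hN.triangle i j k
  · rw [Bnd.less_eq_false_iff, Bnd.toLowerSet_zero]
    refine le_trans ?_ (hM.sets_zero_le j)
    exact (sets_relax M a b w 0 j).le.trans (min_le_left _ _)

theorem Canonical.sols_relax {M : DBM n} (hM : M.Canonical) (a b : Fin (n + 1)) (w : Bnd) :
    (M.relax a b w).sols = M.sols ∩ {v | w.Sat (v.ext a - v.ext b)} := by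
  ext v
  rw [Set.mem_inter_iff, Set.mem_ofPred_eq, ← Bnd.mem_toLowerSet]
  simp only [mem_sols_iff, sets_relax]
  constructor
  · refine fun h => ⟨fun i j => mem_left_of_mem_min (h i j), ?_⟩
    have := mem_right_of_mem_min (h a b)
    rwa [hM.sets_diag, hM.sets_diag, zero_add, add_zero] at this
  · rintro ⟨h1, h2⟩ i j
    have h3 : v.ext i - v.ext j ∈ M.sets i a + w.toLowerSet + M.sets b j :=
      mem_lowerSet_add.2 ⟨_, mem_lowerSet_add.2 ⟨_, h1 i a, _, h2, rfl⟩, _, h1 b j, by ring⟩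
    rcases min_choice (M.sets i j) (M.sets i a + w.toLowerSet + M.sets b j) with h | h <;> rw [h]
    · exact h1 i j
    · exact h3

theorem represents_meet {M : DBM n} (hM : M.Canonical) (a b : Fin (n + 1)) (w : Bnd) :
    (M.meet a b w).val.Represents (M.sols ∩ {v | w.Sat (v.ext a - v.ext b)}) := by
  rw [meet_val]
  split_ifs with h
  · refine Set.eq_empty_of_forall_notMem ?_
    rintro v ⟨h1, h2⟩
    rw [Bnd.less_iff, Bnd.toLowerSet_zero, Bnd.toLowerSet_add, ← not_le,
      zero_le_lowerSet_iff] at h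
    rw [mem_sols_iff] at h1
    exact h (mem_lowerSet_add.2 ⟨_, Bnd.mem_toLowerSet.2 h2, _, h1 b a, by ring⟩)
  · exact ⟨hM.relax (Bool.eq_false_iff.2 h), hM.sols_relax a b w⟩

theorem represents_meetDiag {M : DBM n} (hM : M.Canonical) (φ : Diag n) :
    (M.meetDiag φ).val.Represents (M.sols ∩ {v | φ.Sat v}) :=
  represents_meet hM _ _ _

theorem _root_.TimedZone.Cmp.holds_dual_neg (s : Cmp) (r c : ℝ) : s.dual.Holds (-r) (-c) ↔ ¬ s.Holds r c := by
  cases s <;> simp [Cmp.dual, Cmp.Holds]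

theorem represents_meetNegDiag {M : DBM n} (hM : M.Canonical) (φ : Diag n) :
    (M.meetNegDiag φ).val.Represents (M.sols ∩ {v | ¬ φ.Sat v}) := by
  have : {v : Valuation n | ¬ φ.Sat v} = {v | (Bnd.fin φ.cmp.dual (-φ.c)).Sat
      (v.ext φ.y.succ - v.ext φ.x.succ)} := by
    ext v
    simp only [Set.mem_ofPred_eq, Bnd.Sat, Diag.Sat, ← Cmp.holds_dual_neg, Valuation.ext_succ,
      neg_sub, Int.cast_neg]
  rw [this]
  exact represents_meet hM _ _ _

/-- The matrix without constraints other than `0 ≤ x`. -/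
def univ (n : ℕ) : DBM n := fun i j => if i = 0 ∨ i = j then Bnd.zero else Bnd.inf

theorem canonical_univ (n : ℕ) : (univ n).Canonical where
  diag i := by simp [univ]
  triangle i j k := by
    unfold univ
    split_ifs <;> first | rfl | (exfalso; grind)
  nonneg j := by simp [univ]; rfl

theorem sols_univ (n : ℕ) : (univ n).sols = Set.univ := by
  refine Set.eq_univ_of_forall fun v i j => ?_
  unfold univ
  split_ifs with h
  · have := v.ext_nonneg j
    rcases h with rfl | rfl <;> simp [Bnd.zero, Bnd.Sat, Cmp.Holds, this]
  · trivial

end DBM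

theorem ZoneAtom.exists_bnd {n : ℕ} (φ : ZoneAtom n) :
    ∃ a b w, ∀ v : Valuation n, φ.Sat v ↔ Bnd.Sat (v.ext a - v.ext b) w := by
  rcases φ with ⟨x, s, c⟩ | ⟨c, s, x⟩ | ⟨x, y, s, c⟩
  · exact ⟨x.succ, 0, .fin s c, fun v => by simp [Sat, Bnd.Sat]⟩
  · refine ⟨0, x.succ, .fin s (-c), fun v => ?_⟩
    cases s <;> simp [Sat, Bnd.Sat, Cmp.Holds]
  · exact ⟨x.succ, y.succ, .fin s c, fun v => by simp [Sat, Bnd.Sat]⟩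

theorem IsZone.exists_represents {n : ℕ} {Z : Set (Valuation n)} (hZ : IsZone Z) :
    ∃ M : ZoneRep n, M.Represents Z := by
  classical
  obtain ⟨S, rfl⟩ := hZ
  induction S using Finset.induction_on with
  | empty => exact ⟨some (DBM.univ n), DBM.canonical_univ n, by simp [DBM.sols_univ]⟩
  | insert φ S _ ih =>
    obtain ⟨M, hM⟩ := ih
    obtain ⟨a, b, w, h⟩ := φ.exists_bnd
    have hS : {v : Valuation n | ∀ ψ ∈ insert φ S, ψ.Sat v} =
        {v | ∀ ψ ∈ S, ψ.Sat v} ∩ {v | Bnd.Sat (v.ext a - v.ext b) w} := by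
      ext v
      simp [← h, and_comm]
    rw [hS]
    cases M with
    | none =>
      have hM' : {v : Valuation n | ∀ ψ ∈ S, ψ.Sat v} = ∅ := hM
      exact ⟨none, by rw [hM', Set.empty_inter]; rfl⟩
    | some M =>
      rw [← hM.2]
      exact ⟨_, DBM.represents_meet hM.1 a b w⟩

/-! ### The simulation test -/

theorem luTest_val {n : ℕ} (L U : Fin n → WithBot ℕ) (M M' : DBM n) :
    (luTest L U M M').val = true ↔
      ∀ x y, ¬ IsLUWitness (Fin.cons 0 L) (Fin.cons 0 U) M M' x y := by
  unfold luTest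
  rw [loop_val_bool (P := fun x => ∀ y, ¬ IsLUWitness (Fin.cons 0 L) (Fin.cons 0 U) M M' x y)]
  · simp
  · intro x ok
    rw [loop_val_bool (P := fun y => ¬ IsLUWitness (Fin.cons 0 L) (Fin.cons 0 U) M M' x y)]
    intro y ok'
    rw [← luWitness_val]
    simp

/-- Reading a pair of bounds and testing it costs at most 10 steps, accumulating the result one
more, and the loop counter makes 12. -/
theorem luTest_time_le {n : ℕ} (L U : Fin n → WithBot ℕ) (M M' : DBM n) :
    (luTest L U M M').time ≤ (n + 1) * ((n + 1) * 12 + 1) := by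
  refine loop_time_le fun x ok => loop_time_le (T := 11) fun y ok' => ?_
  have h : (luWitness (Fin.cons 0 L) (Fin.cons 0 U) M M' x y).time ≤ 10 := by
    unfold luWitness
    simp only [time_bind, time_op, val_op]
    split <;> simp
  simp only [time_bind, time_op]
  omega

theorem decides_luTest {n : ℕ} (L U : Fin n → WithBot ℕ) :
    Decides (luTest L U) (LUSim L U) := by
  intro M M' hM hM'
  rw [luTest_val]
  refine ⟨setSim_of_forall_not_isLUWitness hM', fun h x y hw => hw.not_setSim hM h⟩

variable {n : ℕ}

/-! ### Correctness of the two procedures -/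

/-- `v` and `v'` are related by `R`, and `v'` satisfies all the constraints of `D` that `v`
satisfies. -/
def DiagSim (R : Valuation n → Valuation n → Prop) (D : List (Diag n)) (v v' : Valuation n) :
    Prop :=
  R v v' ∧ ∀ φ ∈ D, φ.Sat v → φ.Sat v'

/-- Where `φ` fails on the left it demands nothing of the partner; where it holds, the partner must
lie in `Z'` ∩ `φ`. -/
theorem setSim_diagSim_pick (R : Valuation n → Valuation n → Prop) (G₁ G₂ : List (Diag n))
    (φ : Diag n) (Z Z' : Set (Valuation n)) :
    SetSim (DiagSim R (G₁ ++ φ :: G₂)) Z Z' ↔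
      SetSim (DiagSim R (G₁ ++ G₂)) (Z ∩ {v | ¬ φ.Sat v}) Z' ∧
      SetSim (DiagSim R (G₁ ++ G₂)) (Z ∩ {v | φ.Sat v}) (Z' ∩ {v | φ.Sat v}) := by
  have hD : ∀ v v', DiagSim R (G₁ ++ φ :: G₂) v v' ↔
      DiagSim R (G₁ ++ G₂) v v' ∧ (φ.Sat v → φ.Sat v') := fun v v' => by
    simp only [DiagSim, List.mem_append, List.mem_cons, and_assoc]
    refine and_congr_right fun _ => ⟨fun h => ⟨fun ψ hψ => h ψ (by tauto), h φ (by tauto)⟩, ?_⟩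
    rintro ⟨h1, h2⟩ ψ (hψ | rfl | hψ)
    · exact h1 ψ (Or.inl hψ)
    · exact h2
    · exact h1 ψ (Or.inr hψ)
  constructor
  · refine fun h => ⟨fun v hv => ?_, fun v hv => ?_⟩ <;>
      obtain ⟨v', hv', hvv'⟩ := h v hv.1 <;> rw [hD] at hvv'
    · exact ⟨v', hv', hvv'.1⟩
    · exact ⟨v', ⟨hv', hvv'.2 hv.2⟩, hvv'.1⟩
  · rintro ⟨h1, h2⟩ v hv
    by_cases hφ : φ.Sat v
    · obtain ⟨v', hv', hvv'⟩ := h2 v ⟨hv, hφ⟩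
      exact ⟨v', hv'.1, (hD _ _).2 ⟨hvv', fun _ => hv'.2⟩⟩
    · obtain ⟨v', hv', hvv'⟩ := h1 v ⟨hv, hφ⟩
      exact ⟨v', hv', (hD _ _).2 ⟨hvv', fun h => (hφ h).elim⟩⟩

/-- The set represented by a value of the data structure for zones. -/
def ZoneRep.sols : ZoneRep n → Set (Valuation n)
  | none => ∅
  | some M => M.sols

theorem ZoneRep.represents_iff {M : ZoneRep n} {Z : Set (Valuation n)} :
    M.Represents Z ↔ (∀ N ∈ M, N.Canonical) ∧ M.sols = Z := by
  cases M with
  | none => simp [Represents, sols, eq_comm]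
  | some M => simp [Represents, sols]

/-- The value that the last line of the second procedure should return. -/
def Frame.Holds (R : Valuation n → Valuation n → Prop) (F : Frame n) : Prop :=
  SetSim (DiagSim R F.rest) (F.Z.sols ∩ {v | F.φ.Sat v}) (F.Z'.sols ∩ {v | F.φ.Sat v})

/-- All the matrices of a call stack are canonical. -/
def StackCanonical (K : List (Frame n)) : Prop :=
  ∀ F ∈ K, F.Z.Canonical ∧ F.Z'.Canonical

/-- The invariant of the two procedures. -/
def Config.Valid (R : Valuation n → Valuation n → Prop) : Config n → Prop
  | .check _ Z Z' K => ((∀ N ∈ Z, N.Canonical) ∧ ∀ N ∈ Z', N.Canonical) ∧ StackCanonical K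
  | .checkStar _ Z Z' K =>
    (Z.Canonical ∧ Z'.Canonical ∧ SetSim R Z.sols Z'.sols) ∧ StackCanonical K
  | .lastLine F K => (F.Z.Canonical ∧ F.Z'.Canonical) ∧ StackCanonical K
  | .ret _ K => StackCanonical K

/-- Whether the outermost call should return `true`. -/
def Config.Holds (R : Valuation n → Valuation n → Prop) : Config n → Prop
  | .check G Z Z' K => SetSim (DiagSim R G) Z.sols Z'.sols ∧ ∀ F ∈ K, F.Holds R
  | .checkStar G Z Z' K => SetSim (DiagSim R G) Z.sols Z'.sols ∧ ∀ F ∈ K, F.Holds R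
  | .lastLine F K => F.Holds R ∧ ∀ F ∈ K, F.Holds R
  | .ret b K => b = true ∧ ∀ F ∈ K, F.Holds R

/-- The last line is a tail call, so the outermost answer is the conjunction of the current call and
all pending last lines. Validity of `checkStar` carries the oracle's positive answer: it passes to
the subset `Z` ∩ ¬`φ` without a new test, and it justifies returning `true` when no diagonal is
left. -/
theorem Step.valid_and_holds_iff {oracle : DBM n → DBM n → Timed Bool}
    {R : Valuation n → Valuation n → Prop} (ho : Decides oracle R) {c c' : Config n} {t : ℕ}
    (h : Step oracle c t c') (hc : c.Valid R) : c'.Valid R ∧ (c'.Holds R ↔ c.Holds R) := by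
  cases h with
  | leftEmpty G Z' K =>
    exact ⟨hc.2, and_congr_left fun _ => iff_of_true rfl fun v hv => hv.elim⟩
  | rightEmpty G Z K =>
    refine ⟨hc.2, and_congr_left fun _ => iff_of_false Bool.false_ne_true fun h => ?_⟩
    obtain ⟨v, hv⟩ := (hc.1.1 Z rfl).sols_nonempty
    obtain ⟨_, hv', _⟩ := h v hv
    exact hv'
  | oracleFails G Z Z' K h =>
    refine ⟨hc.2, and_congr_left fun _ => iff_of_false Bool.false_ne_true fun h' => ?_⟩
    have : SetSim R Z.sols Z'.sols := fun v hv => (h' v hv).imp fun v' hv' => ⟨hv'.1, hv'.2.1⟩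
    rw [← ho Z Z' (hc.1.1 Z rfl) (hc.1.2 Z' rfl), h] at this
    exact Bool.false_ne_true this
  | oracleHolds G Z Z' K h =>
    have hZ := hc.1.1 Z rfl
    have hZ' := hc.1.2 Z' rfl
    exact ⟨⟨⟨hZ, hZ', (ho Z Z' hZ hZ').1 h⟩, hc.2⟩, Iff.rfl⟩
  | noDiag Z Z' K =>
    exact ⟨hc.2, and_congr_left fun _ => iff_of_true rfl fun v hv =>
      (hc.1.2.2 v hv).imp fun v' hv' => ⟨hv'.1, hv'.2, by simp⟩⟩
  | pickCall G₁ φ G₂ Z Z' K N h =>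
    obtain ⟨⟨hZ, hZ', hs⟩, hK⟩ := hc
    have hN := DBM.represents_meetNegDiag hZ φ
    rw [h] at hN
    refine ⟨⟨⟨hN.1, hZ', fun v hv => hs v (hN.2.subset hv).1⟩, ?_⟩, ?_⟩
    · exact List.forall_mem_cons.2 ⟨⟨hZ, hZ'⟩, hK⟩
    · simp only [Config.Holds, List.forall_mem_cons]
      rw [setSim_diagSim_pick, hN.2, and_assoc]
      rfl
  | pickSkip G₁ φ G₂ Z Z' K h =>
    obtain ⟨⟨hZ, hZ', hs⟩, hK⟩ := hc
    have hN : Z.sols ∩ {v | ¬ φ.Sat v} = ∅ := by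
      have := DBM.represents_meetNegDiag hZ φ
      rwa [h] at this
    refine ⟨⟨⟨hZ, hZ'⟩, hK⟩, and_congr_left fun _ => ?_⟩
    rw [setSim_diagSim_pick, hN]
    exact ⟨fun h => ⟨fun v hv => hv.elim, h⟩, And.right⟩
  | retFalse F K =>
    exact ⟨(List.forall_mem_cons.1 hc).2, iff_of_false (fun h => Bool.false_ne_true h.1)
      fun h => Bool.false_ne_true h.1⟩
  | retTrue F K =>
    refine ⟨List.forall_mem_cons.1 hc, ?_⟩
    simp [Config.Holds]
  | lastCall F K =>
    have h1 := ZoneRep.represents_iff.1 (DBM.represents_meetDiag hc.1.1 F.φ)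
    have h2 := ZoneRep.represents_iff.1 (DBM.represents_meetDiag hc.1.2 F.φ)
    refine ⟨⟨⟨h1.1, h2.1⟩, hc.2⟩, ?_⟩
    simp only [Config.Holds, h1.2, h2.2]
    rfl

theorem Run.valid_and_holds_iff {oracle : DBM n → DBM n → Timed Bool}
    {R : Valuation n → Valuation n → Prop} (ho : Decides oracle R) {c c' : Config n} {t : ℕ}
    (h : Run oracle c t c') (hc : c.Valid R) : c'.Valid R ∧ (c'.Holds R ↔ c.Holds R) := by
  induction h with
  | refl => exact ⟨hc, Iff.rfl⟩
  | tail _ hs ih =>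
    have := hs.valid_and_holds_iff ho ih.1
    exact ⟨this.1, this.2.trans ih.2⟩

/-- Only a return from the outermost call is final. -/
theorem exists_step_or_eq_ret (oracle : DBM n → DBM n → Timed Bool) (c : Config n) :
    (∃ t c', Step oracle c t c') ∨ ∃ b, c = .ret b [] := by
  rcases c with ⟨G, _ | Z, Z', K⟩ | ⟨_ | ⟨φ, G⟩, Z, Z', K⟩ | ⟨F, K⟩ | ⟨b, _ | ⟨F, K⟩⟩
  · exact Or.inl ⟨_, _, .leftEmpty _ _ _⟩
  · left
    cases Z' with
    | none => exact ⟨_, _, .rightEmpty _ _ _⟩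
    | some Z' =>
      cases h : (oracle Z Z').val
      · exact ⟨_, _, .oracleFails _ _ _ _ h⟩
      · exact ⟨_, _, .oracleHolds _ _ _ _ h⟩
  · exact Or.inl ⟨_, _, .noDiag _ _ _⟩
  · left
    cases h : (DBM.meetNegDiag Z φ).val with
    | none => exact ⟨_, _, .pickSkip [] φ G _ _ _ h⟩
    | some N => exact ⟨_, _, .pickCall [] φ G _ _ _ N h⟩
  · exact Or.inl ⟨_, _, .lastCall _ _⟩
  · exact Or.inr ⟨b, rfl⟩
  · left
    cases b
    · exact ⟨_, _, .retFalse _ _⟩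
    · exact ⟨_, _, .retTrue _ _⟩

theorem answers_check {oracle : DBM n → DBM n → Timed Bool}
    {R : Valuation n → Valuation n → Prop} (ho : Decides oracle R) (D : List (Diag n))
    {Z Z' : Set (Valuation n)} {M M' : ZoneRep n} (hM : M.Represents Z)
    (hM' : M'.Represents Z') :
    Answers oracle (.check D M M' []) (SetSim (DiagSim R D) Z Z') := by
  intro t c' hrun hstuck
  rw [ZoneRep.represents_iff] at hM hM'
  have h := (hrun.valid_and_holds_iff ho ⟨⟨hM.1, hM'.1⟩, by simp [StackCanonical]⟩).2
  obtain ⟨b, rfl⟩ := (exists_step_or_eq_ret oracle c').resolve_left hstuck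
  refine ⟨b, rfl, ?_⟩
  simpa [Config.Holds, hM.2, hM'.2] using h

/-! ### Termination and running time -/

/-- A bound on the time of a call of the second procedure, with `d` diagonal constraints, when
the oracle takes at most `A` steps and an intersection at most `B` steps. -/
def starTime (A B : ℕ) : ℕ → ℕ
  | 0 => 1
  -- The pick costs at most `d + 3 + B`, a return 1, and the last line `4 + 2 * B + A` besides its
  -- recursive call.
  | d + 1 => 2 * starTime A B d + d + (8 + A + 3 * B)

/-- A bound on the time of the last line of the second procedure. -/
def lineTime (A B d : ℕ) : ℕ := 4 + 2 * B + A + starTime A B d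

/-- A bound on the time taken after the current call has returned. -/
def stackTime (A B : ℕ) : List (Frame n) → ℕ
  | [] => 0
  | F :: K => 1 + lineTime A B F.rest.length + stackTime A B K

/-- A bound on the time that remains. -/
def Config.remainingTime (A B : ℕ) : Config n → ℕ
  | .check G _ _ K => 3 + A + starTime A B G.length + stackTime A B K
  | .checkStar G _ _ K => starTime A B G.length + stackTime A B K
  | .lastLine F K => lineTime A B F.rest.length + stackTime A B K
  | .ret _ K => stackTime A B K

/-- The added terms solve the recurrence: with them the left side exactly doubles from `d` to `d +
1`, which absorbs the linear cost of list removal. -/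
theorem starTime_add_le (A B d : ℕ) :
    starTime A B d + d + (9 + A + 3 * B) ≤ 2 ^ d * (10 + A + 3 * B) := by
  induction d with
  | zero => simp only [starTime, pow_zero]; omega
  | succ d ih => simp only [starTime, pow_succ]; linarith

theorem Step.time_add_remainingTime_le {oracle : DBM n → DBM n → Timed Bool} {A B : ℕ}
    (hA : ∀ M M', (oracle M M').time ≤ A)
    (hB : ∀ (M : DBM n) a b w, (M.meet a b w).time ≤ B) {c c' : Config n} {t : ℕ}
    (h : Step oracle c t c') :
    1 ≤ t ∧ t + c'.remainingTime A B ≤ c.remainingTime A B := by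
  have hB1 : ∀ (M : DBM n) φ, (M.meetDiag φ).time ≤ B := fun M φ => hB _ _ _ _
  have hB2 : ∀ (M : DBM n) φ, (M.meetNegDiag φ).time ≤ B := fun M φ => hB _ _ _ _
  cases h with
  | leftEmpty G Z' K => simp only [Config.remainingTime]; omega
  | rightEmpty G Z K => simp only [Config.remainingTime]; omega
  | oracleFails G Z Z' K h =>
    have := hA Z Z'
    simp only [Config.remainingTime]; omega
  | oracleHolds G Z Z' K h =>
    have := hA Z Z'
    simp only [Config.remainingTime]; omega
  | noDiag Z Z' K => simp only [Config.remainingTime, List.length_nil, starTime]; omega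
  | pickCall G₁ φ G₂ Z Z' K N h =>
    have := hB2 Z φ
    simp only [Config.remainingTime, List.length_append, List.length_cons, ← add_assoc, starTime,
      stackTime, lineTime]
    omega
  | pickSkip G₁ φ G₂ Z Z' K h =>
    have := hB2 Z φ
    simp only [Config.remainingTime, List.length_append, List.length_cons, ← add_assoc, starTime,
      lineTime]
    omega
  | retFalse F K => simp only [Config.remainingTime, stackTime]; omega
  | retTrue F K => simp only [Config.remainingTime, stackTime]; omega
  | lastCall F K =>
    have := hB1 F.Z F.φ
    have := hB1 F.Z' F.φ
    simp only [Config.remainingTime, lineTime]; omega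

theorem runsWithin_remainingTime {oracle : DBM n → DBM n → Timed Bool} {A B : ℕ}
    (hA : ∀ M M', (oracle M M').time ≤ A)
    (hB : ∀ (M : DBM n) a b w, (M.meet a b w).time ≤ B) (c : Config n) :
    RunsWithin oracle c (c.remainingTime A B) := by
  intro t c' h
  suffices t + c'.remainingTime A B ≤ c.remainingTime A B by omega
  induction h with
  | refl => omega
  | tail _ hs ih =>
    have := (hs.time_add_remainingTime_le hA hB).2
    omega

/-- The transitions do not depend on the time taken by the oracle. -/
theorem Step.congr_oracle {oracle oracle' : DBM n → DBM n → Timed Bool}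
    (ho : ∀ M M', (oracle M M').val = (oracle' M M').val) {c c' : Config n} {t : ℕ}
    (h : Step oracle c t c') : ∃ t', Step oracle' c t' c' := by
  cases h with
  | leftEmpty G Z' K => exact ⟨_, .leftEmpty _ _ _⟩
  | rightEmpty G Z K => exact ⟨_, .rightEmpty _ _ _⟩
  | oracleFails G Z Z' K h => exact ⟨_, .oracleFails _ _ _ _ (ho Z Z' ▸ h)⟩
  | oracleHolds G Z Z' K h => exact ⟨_, .oracleHolds _ _ _ _ (ho Z Z' ▸ h)⟩
  | noDiag Z Z' K => exact ⟨_, .noDiag _ _ _⟩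
  | pickCall G₁ φ G₂ Z Z' K N h => exact ⟨_, .pickCall _ _ _ _ _ _ _ h⟩
  | pickSkip G₁ φ G₂ Z Z' K h => exact ⟨_, .pickSkip _ _ _ _ _ _ h⟩
  | retFalse F K => exact ⟨_, .retFalse _ _⟩
  | retTrue F K => exact ⟨_, .retTrue _ _⟩
  | lastCall F K => exact ⟨_, .lastCall _ _⟩

theorem terminates (oracle : DBM n → DBM n → Timed Bool) (c : Config n) :
    Terminates oracle c := by
  rintro ⟨f, -, hf⟩
  obtain ⟨i, hi⟩ := WellFounded.not_rel_apply_succ (r := (· < ·)) fun i =>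
    (f i).remainingTime 0 (3 + (n + 1) * (n + 1) + (n + 1) * ((n + 1) * 8 + 1))
  refine hi ?_
  obtain ⟨t, ht⟩ := hf i
  -- The oracle's time need not be bounded over all matrices, so the potential is applied to a
  -- cost-free oracle with the same answers.
  let timeless : DBM n → DBM n → Timed Bool := fun M M' => pure (oracle M M').val
  have ho : ∀ M M', (oracle M M').val = (timeless M M').val := fun _ _ => rfl
  obtain ⟨t', ht'⟩ := ht.congr_oracle ho
  have := ht'.time_add_remainingTime_le (A := 0) (fun _ _ => le_rfl) DBM.meet_time_le
  omega

theorem ListsDiags.numDiag_eq {D : List (Diag n)} {G : Finset (Atom n)} (h : ListsDiags D G) :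
    numDiag G = D.length := by
  classical
  have hset : {φ : Atom n | φ ∈ G ∧ φ.IsDiag} = Atom.diag '' (D.toFinset : Set (Diag n)) := by
    ext φ
    constructor
    · rintro ⟨h1, h2⟩
      cases φ with
      | upper => exact h2.elim
      | lower => exact h2.elim
      | diag φ => exact ⟨φ, by simpa using (h.2 φ).2 h1, rfl⟩
    · rintro ⟨φ, h1, rfl⟩
      exact ⟨(h.2 φ).1 (by simpa using h1), trivial⟩
  rw [numDiag, hset, Set.ncard_image_of_injective _ fun _ _ => Atom.diag.inj,
    Set.ncard_coe_finset, List.toFinset_card_of_nodup h.1]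

theorem runsWithin_luTest {D : List (Diag n)} {G : Finset (Atom n)} (h : ListsDiags D G)
    (hn : 1 ≤ n) (M M' : ZoneRep n) :
    RunsWithin (luTest (lowerBounds G) (upperBounds G)) (.check D M M' [])
      (236 * (2 ^ numDiag G * n ^ 2)) := by
  intro t c' hrun
  -- From n + 1 ≤ 2n, the test takes at most 48n² + 2n steps and an intersection at most 36n² + 2n +
  -- 3. The constant is 236 = (10 + 50 + 3·41) + (3 + 50), the last bracket for the outermost call.
  refine (runsWithin_remainingTime (A := 50 * n ^ 2) (B := 41 * n ^ 2)
    (fun M M' => (luTest_time_le _ _ M M').trans ?_)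
    (fun M a b w => (M.meet_time_le a b w).trans ?_) _ t c' hrun).trans ?_
  · nlinarith
  · nlinarith
  · have h1 := starTime_add_le (50 * n ^ 2) (41 * n ^ 2) D.length
    have h2 : 1 ≤ 2 ^ D.length := Nat.one_le_two_pow
    have h3 : 1 ≤ n ^ 2 := Nat.one_le_pow _ _ hn
    simp only [Config.remainingTime, stackTime]
    rw [h.numDiag_eq]
    nlinarith [Nat.mul_le_mul_left (2 ^ D.length) h3]

/-! ### The two simulations -/

/-- A common delay leaves differences of clocks unchanged, so a diagonal constraint need only be
compared at delay zero. -/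
theorem guardSim_eq_diagSim {D : List (Diag n)} {G : Finset (Atom n)} (h : ListsDiags D G) :
    GuardSim (G : Set (Atom n)) = DiagSim (GuardSim (nonDiag (G : Set (Atom n)))) D := by
  have hdelay : ∀ (φ : Diag n) (v : Valuation n) δ, φ.Sat (v.delay δ) ↔ φ.Sat v := fun φ v δ => by
    simp [Diag.Sat, Valuation.delay]
  funext v v'
  refine propext ⟨fun hs => ⟨fun φ hφ => hs φ hφ.1, fun φ hφ hv => ?_⟩, ?_⟩
  · rw [← hdelay φ v' 0]
    exact hs (.diag φ) ((h.2 φ).1 hφ) 0 ((hdelay φ v 0).2 hv)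
  · rintro ⟨h1, h2⟩ φ hφ δ hv
    cases φ with
    | upper x s c => exact h1 _ ⟨hφ, id⟩ δ hv
    | lower c s x => exact h1 _ ⟨hφ, id⟩ δ hv
    | diag φ => exact (hdelay φ v' δ).2 (h2 φ ((h.2 φ).2 hφ) ((hdelay φ v δ).1 hv))

theorem luGuardSim_eq_diagSim {D : List (Diag n)} {G : Finset (Atom n)} (h : ListsDiags D G) :
    LUGuardSim G = DiagSim (LUSim (lowerBounds G) (upperBounds G)) D := by
  funext v v'
  simp only [LUGuardSim, DiagSim, h.2]

end TimedZone

open TimedZone in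
theorem mainTheorem5 :
    (∀ (n : ℕ) (Z : Set (Valuation n)), IsZone Z → ∃ M : ZoneRep n, M.Represents Z) ∧
    (∀ (n : ℕ) (G : Finset (Atom n)) (D : List (Diag n)), ListsDiags D G →
      ∀ oracle : DBM n → DBM n → Timed Bool,
        Decides oracle (GuardSim (nonDiag (G : Set (Atom n)))) →
      ∀ (Z Z' : Set (Valuation n)) (M M' : ZoneRep n), M.Represents Z → M'.Represents Z' →
        Terminates oracle (.check D M M' []) ∧
        Answers oracle (.check D M M' []) (SetSim (GuardSim (G : Set (Atom n))) Z Z')) ∧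
    (∃ C : ℕ, ∀ (n : ℕ) (G : Finset (Atom n)) (D : List (Diag n)), ListsDiags D G →
      ∀ (Z Z' : Set (Valuation n)) (M M' : ZoneRep n), M.Represents Z → M'.Represents Z' →
        Terminates (luTest (lowerBounds G) (upperBounds G)) (.check D M M' []) ∧
        Answers (luTest (lowerBounds G) (upperBounds G)) (.check D M M' [])
          (SetSim (LUGuardSim G) Z Z') ∧
        (1 ≤ n →
          RunsWithin (luTest (lowerBounds G) (upperBounds G)) (.check D M M' [])
            (C * (2 ^ numDiag G * n ^ 2)))) := by
  refine ⟨fun n Z hZ => hZ.exists_represents, fun n G D hD oracle ho Z Z' M M' hM hM' => ?_,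
    236, fun n G D hD Z Z' M M' hM hM' => ?_⟩
  · rw [guardSim_eq_diagSim hD]
    exact ⟨terminates _ _, answers_check ho D hM hM'⟩
  · rw [luGuardSim_eq_diagSim hD]
    exact ⟨terminates _ _, answers_check (decides_luTest _ _) D hM hM',
      fun hn => runsWithin_luTest hD hn M M'⟩
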